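/- \textbf{Corollary (Merit-order dispatch solution with large inflexible power capacity).} Consider a power system with inflexible, flexible and stochastic generation of capacities $\overline p_I,\overline p_F,\overline p_W>0$, marginal costs $c_I,c_F>0$ and $0$, upward and downward regulation costs $c_F^+,c_F^-$ of the flexible unit and curtailment cost $v$, where $v>c_F^+\ge c_F\ge c_F^-\ge 0$ and $c_I<c_F$. Let the stochastic production be a random variable $W$ on a probability space $(\Omega,\mathcal F,P)$ with $0\le W\le\overline p_W$ a.s. and $P(W=0)<1$, with cumulative distribution function $F$. Let the demand be $l\ge0$, let $\widehat p_W\ge 0$, and define $$A(x)=(v-c_F^+)F(x-\overline p_F)+c_F^+F(x),\qquad l_2=\min\{x\ge 0: A(x)\ge c_I\}.$$ All scenario-wise quantities are random variables and scenario-wise conditions are understood almost surely. \emph{Centralized dispatch.} Minimize $c_Ip_I+c_Fp_F+E[c_F^+p_F^+-c_F^-p_F^-+vs]$ over $p_F,p_I,p_W$ and $p_F^+,p_F^-,\Delta p_W,s$ subject to $p_F^+-p_F^-+\Delta p_W+s=0$, $0\le p_F^+\le\overline p_F-p_F$, $0\le p_F^-\le p_F$, $0\le p_W\le\overline p_W$,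 $0\le p_W+\Delta p_W\le W$, $0\le s\le l$, and subject to $(p_F,p_I)$ minimizing $c_Fx_F+c_Ix_I$ over all $(x_F,x_I)$ with $x_F+x_I+p_W=l$, $0\le x_F\le\overline p_F$, $0\le x_I\le\overline p_I$. \emph{Virtual bidding.} An equilibrium consists of $p_F,p_I,p_W,p_V,\lambda^f$ and of $p_F^+,p_F^-,\Delta p_W,s,\Delta p_V,\lambda^b$, with $\lambda^b$ integrable, satisfying simultaneously the KKT conditions of the following three problems. (i) Minimize $c_Fp_F+c_Ip_I$ over $(p_F,p_I,p_W)$ subject to $p_F+p_I+p_W+p_V=l$ (multiplier $\lambda^f$), $0\le p_W\le\widehat p_W$, $0\le p_F\le\overline p_F$, $0\le p_I\le\overline p_I$. (ii) In each scenario, minimize $c_F^+p_F^+-c_F^-p_F^-+vs$ over $(p_F^+,p_F^-,\Delta p_W,s)$ subject to $p_F^+-p_F^-+\Delta p_W+\Delta p_V+s=0$ (multiplier $\lambda^b$), $0\le p_F^+\le\overline p_F-p_F$, $0\le p_F^-\le p_F$, $0\le p_W+\Delta p_W\le W$, $0\le s\le l$. (iii) Maximize $p_V\lambda^f+E[\Delta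 p_V\lambda^b]$ over $(p_V,\Delta p_V)$ subject to $p_V+\Delta p_V=0$. The multipliers $\lambda^f,\lambda^b$ are prices: the Lagrangians of (i) and (ii) are the cost minus the multiplier times (supply minus demand). The dispatch induced by an equilibrium is $(p_F,p_I,p_W+p_V;\,p_F^+,p_F^-,\Delta p_W+\Delta p_V,s)$. Suppose $\overline p_I\ge l$. Then the minimum defining $l_2$ exists, and the set of optimal solutions $(p_F,p_I,p_W;\,p_F^+,p_F^-,\Delta p_W,s)$ of the centralized-dispatch bilevel problem equals the set of dispatches induced by the virtual-bidding equilibria. The forward dispatch is as follows. \begin{enumerate} \item If $0\le l\le l_2$, then solutions exist, and all of them have $p_W=l$, $p_I=0$, $p_F=0$. \item If $l>l_2$, then there is a solution with $p_W=l_2$, $p_I=l-l_2$, $p_F=0$. Every solution has $p_F=0$, $p_I=l-p_W$ and $p_W\ge l_2$. If $A(x)>c_I$ for all $x>l_2$, then every solution has $p_W=l_2$, $p_I=l-l_2$, $p_F=0$. \end{enumerate} (In the virtual-bidding equilibrium, $p_W$ in these rules stands for $p_W+p_V$.) -/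

import Mathlib

open MeasureTheory

/-- The stylized power system: capacities and costs of the inflexible (`I`), flexible (`F`) and
stochastic (`W`) technologies, upward (`cUp`) and downward (`cDn`) regulation costs, the cost `v`
of involuntary load curtailment, and the random stochastic power production `W`. -/
structure PowerSystem {Ω : Type*} [MeasurableSpace Ω] (P : Measure Ω) where
  capI : ℝ
  capF : ℝ
  capW : ℝ
  cI : ℝ
  cF : ℝ
  cUp : ℝ
  cDn : ℝ
  v : ℝ
  W : Ω → ℝ
  capI_pos : 0 < capI
  capF_pos : 0 < capF
  capW_pos : 0 < capW
  cI_pos : 0 < cI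
  cF_pos : 0 < cF
  cUp_lt_v : cUp < v
  cF_le_cUp : cF ≤ cUp
  cDn_le_cF : cDn ≤ cF
  cDn_nonneg : 0 ≤ cDn
  measurable_W : Measurable W
  W_mem : ∀ᵐ ω ∂P, 0 ≤ W ω ∧ W ω ≤ capW

/-- A forward dispatch `(p_F, p_I, p_W)`. -/
structure ForwardDispatch where
  pF : ℝ
  pI : ℝ
  pW : ℝ

/-- A re-dispatch rule: upward and downward regulation of the flexible unit, adjustment of the
stochastic production, and load shedding, in each scenario. -/
structure Redispatch (Ω : Type*) where
  up : Ω → ℝ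
  dn : Ω → ℝ
  dW : Ω → ℝ
  shed : Ω → ℝ

/-- The re-dispatch quantities are random variables. -/
def Redispatch.IsMeasurable {Ω : Type*} [MeasurableSpace Ω] (r : Redispatch Ω) : Prop :=
  Measurable r.up ∧ Measurable r.dn ∧ Measurable r.dW ∧ Measurable r.shed

/-- The KKT conditions attached to one scalar variable `x` of a minimization problem with bounds
`lo ≤ x ≤ hi`, where `g` is the partial derivative, with respect to `x`, of the objective minus
(price times balance constraint): primal feasibility, stationarity, dual feasibility and
complementary slackness, with multipliers `α`, `β` for the lower and the upper bound. -/
def BoxKKT (g lo x hi : ℝ) : Prop :=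
  lo ≤ x ∧ x ≤ hi ∧
    ∃ α β : ℝ, 0 ≤ α ∧ 0 ≤ β ∧ g - α + β = 0 ∧ α * (x - lo) = 0 ∧ β * (hi - x) = 0

namespace PowerSystem

variable {Ω : Type*} [MeasurableSpace Ω] {P : Measure Ω}

/-- The cumulative distribution function of the stochastic power production. -/
noncomputable def cdfW (S : PowerSystem P) (x : ℝ) : ℝ :=
  ProbabilityTheory.cdf (P.map S.W) x

/-- The function `(v - c_F⁺) F(x - p̄_F) + c_F⁺ F(x)`. -/
noncomputable def expectedPrice (S : PowerSystem P) (x : ℝ) : ℝ :=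
  (S.v - S.cUp) * S.cdfW (x - S.capF) + S.cUp * S.cdfW x

/-- The loads `x ≥ 0` with `(v - c_F⁺) F(x - p̄_F) + c_F⁺ F(x) ≥ c_I`. -/
def l2Set (S : PowerSystem P) : Set ℝ :=
  {x | 0 ≤ x ∧ S.cI ≤ S.expectedPrice x}

/-- The constant `l₂`, the minimum of `l2Set`. -/
noncomputable def l2 (S : PowerSystem P) : ℝ := sInf S.l2Set

/-! ### Centralized dispatch: the bilevel problem -/

/-- `(x_F, x_I)` is feasible for the forward market (lower-level problem) given `p_W`. -/
def LowerFeasible (S : PowerSystem P) (l pW xF xI : ℝ) : Prop :=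
  xF + xI + pW = l ∧ 0 ≤ xF ∧ xF ≤ S.capF ∧ 0 ≤ xI ∧ xI ≤ S.capI

/-- `(p_F, p_I)` solves the forward market clearing (lower-level problem) given `p_W`. -/
def LowerOptimal (S : PowerSystem P) (l pW pF pI : ℝ) : Prop :=
  S.LowerFeasible l pW pF pI ∧
    ∀ xF xI : ℝ, S.LowerFeasible l pW xF xI → S.cF * pF + S.cI * pI ≤ S.cF * xF + S.cI * xI

/-- Feasible points of the bilevel problem. -/
def BilevelFeasible (S : PowerSystem P) (l : ℝ) (d : ForwardDispatch) (r : Redispatch Ω) : Prop :=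
  r.IsMeasurable ∧
  0 ≤ d.pW ∧ d.pW ≤ S.capW ∧
  (∀ᵐ ω ∂P,
    r.up ω - r.dn ω + r.dW ω + r.shed ω = 0 ∧
    (0 ≤ r.up ω ∧ r.up ω ≤ S.capF - d.pF) ∧
    (0 ≤ r.dn ω ∧ r.dn ω ≤ d.pF) ∧
    (0 ≤ d.pW + r.dW ω ∧ d.pW + r.dW ω ≤ S.W ω) ∧
    (0 ≤ r.shed ω ∧ r.shed ω ≤ l)) ∧
  S.LowerOptimal l d.pW d.pF d.pI

/-- The expected total operating cost. At feasible points the integrand is measurable and almost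
surely bounded, so the integral is a genuine expectation. -/
noncomputable def expectedCost (S : PowerSystem P) (d : ForwardDispatch) (r : Redispatch Ω) : ℝ :=
  S.cI * d.pI + S.cF * d.pF + ∫ ω, (S.cUp * r.up ω - S.cDn * r.dn ω + S.v * r.shed ω) ∂P

/-- The (globally optimal) solutions of the bilevel problem at load `l`. -/
def bilevelSolutions (S : PowerSystem P) (l : ℝ) : Set (ForwardDispatch × Redispatch Ω) :=
  {x | S.BilevelFeasible l x.1 x.2 ∧
    ∀ (d : ForwardDispatch) (r : Redispatch Ω), S.BilevelFeasible l d r →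
      S.expectedCost x.1 x.2 ≤ S.expectedCost d r}

/-! ### Virtual bidding: the complementarity problem -/

/-- KKT conditions of the forward market clearing with virtual bid `pV`, cap `pHat` on the
stochastic production, and forward price `lamF` (multiplier of the balance constraint). -/
def ForwardKKT (S : PowerSystem P) (l pHat pV lamF : ℝ) (d : ForwardDispatch) : Prop :=
  d.pF + d.pI + d.pW + pV = l ∧
  BoxKKT (S.cF - lamF) 0 d.pF S.capF ∧
  BoxKKT (S.cI - lamF) 0 d.pI S.capI ∧
  BoxKKT (-lamF) 0 d.pW pHat

/-- KKT conditions of the balancing market clearing in scenario `ω`, with balancing price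
`lamB ω` (multiplier of the balance constraint). -/
def BalancingKKT (S : PowerSystem P) (l : ℝ) (d : ForwardDispatch) (r : Redispatch Ω)
    (dV lamB : Ω → ℝ) (ω : Ω) : Prop :=
  r.up ω - r.dn ω + r.dW ω + dV ω + r.shed ω = 0 ∧
  BoxKKT (S.cUp - lamB ω) 0 (r.up ω) (S.capF - d.pF) ∧
  BoxKKT (-S.cDn + lamB ω) 0 (r.dn ω) d.pF ∧
  BoxKKT (-lamB ω) (-d.pW) (r.dW ω) (S.W ω - d.pW) ∧
  BoxKKT (S.v - lamB ω) 0 (r.shed ω) l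

/-- KKT conditions of the arbitrager's problem, with multiplier `η ω` for the constraint
`pV + dV ω = 0`: feasibility, and stationarity with respect to `pV` and to `dV ω`. -/
def ArbitragerKKT (P : Measure Ω) (lamF : ℝ) (lamB : Ω → ℝ) (pV : ℝ) (dV : Ω → ℝ) : Prop :=
  (∀ᵐ ω ∂P, pV + dV ω = 0) ∧
  ∃ η : Ω → ℝ, Integrable η P ∧ lamF - ∫ ω, η ω ∂P = 0 ∧ ∀ᵐ ω ∂P, lamB ω - η ω = 0

/-- Short-run equilibrium with virtual bidding: all three KKT systems hold simultaneously. -/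
def IsEquilibrium (S : PowerSystem P) (l pHat : ℝ) (d : ForwardDispatch) (r : Redispatch Ω)
    (pV : ℝ) (dV : Ω → ℝ) (lamF : ℝ) (lamB : Ω → ℝ) : Prop :=
  r.IsMeasurable ∧ Measurable dV ∧ Integrable lamB P ∧
  S.ForwardKKT l pHat pV lamF d ∧
  (∀ᵐ ω ∂P, S.BalancingKKT l d r dV lamB ω) ∧
  ArbitragerKKT P lamF lamB pV dV

/-- The dispatches induced by the virtual-bidding equilibria, where the virtual positions are
counted together with the stochastic production: `p_W + p_V` in the forward market and
`Δp_W(ω) + Δp_V(ω)` in the balancing market. -/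
def equilibriumSolutions (S : PowerSystem P) (l pHat : ℝ) :
    Set (ForwardDispatch × Redispatch Ω) :=
  {x | ∃ (d : ForwardDispatch) (r : Redispatch Ω) (pV : ℝ) (dV : Ω → ℝ) (lamF : ℝ) (lamB : Ω → ℝ),
    S.IsEquilibrium l pHat d r pV dV lamF lamB ∧
    x = (⟨d.pF, d.pI, d.pW + pV⟩, ⟨r.up, r.dn, fun ω => r.dW ω + dV ω, r.shed⟩)}

end PowerSystem

/-!
Since `l ≤ p̄_I` and `c_I < c_F`, the forward market given `p_W = x` always clears with `p_F = 0` and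
`p_I = l - x`. The cheapest re-dispatch then is the merit order: first the stochastic production,
next the flexible unit, then load shedding (`meritOrder`), and any other re-dispatch is strictly
more expensive (`recourseCost_le`, `eq_meritOrder_of_cost_le`). Hence the bilevel problem amounts to
minimizing over `0 ≤ x ≤ min l p̄_W` the convex function (`reducedCost`)
`G x = c_I (l - x) + E[c_F⁺ (x - W)⁺ + (v - c_F⁺) (x - W - p̄_F)⁺]`,
see `mem_bilevelSolutions_iff`.

The right derivative of `G` is `expectedPrice x - c_I`, the left one is `leftPrice x - c_I`. Thus `x`
is a minimizer iff `leftPrice x ≤ c_I` and, unless `x = l`, also `c_I ≤ expectedPrice x`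
(`isMinimizer_iff`). The merit-order rules follow, because `expectedPrice` is monotone and
right-continuous and reaches `c_I` at the latest at `p̄_W`.

For the equivalence with virtual bidding, every balancing price between `leftScenarioPrice x` and
`scenarioPrice x` supports the merit order at `x` (`boxKKT_meritOrder`), and the two ends have the
expectations `leftPrice x` and `expectedPrice x`. The optimality condition says that some convex
combination of the two has an expectation that supports `p_I = l - x` in the forward market
(`IsMinimizer.exists_price`), which gives an equilibrium. Conversely, an equilibrium has `p_F = 0`:
otherwise the forward price would be at least `c_F > c_I`, so that `p_I = p̄_I ≥ l` and the flexible
unit is regulated down in every scenario. This bounds the balancing price by `c_F⁻ ≤ c_F`, hence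
fixes it at `c_F > 0`; all stochastic production is then used, and the balance leaves room only for
`W = 0` (`IsEquilibrium.pF_eq_zero`). With `p_F = 0`, optimality of the equilibrium dispatch is
Lagrangian duality with the equilibrium prices as multipliers.
-/

open Filter Topology

/-! ### Box constraints -/

theorem BoxKKT.of_sign {g lo x hi : ℝ} (h1 : lo ≤ x) (h2 : x ≤ hi) (h3 : lo < x → g ≤ 0)
    (h4 : x < hi → 0 ≤ g) : BoxKKT g lo x hi := by
  refine ⟨h1, h2, max g 0, max (-g) 0, le_max_right _ _, le_max_right _ _, ?_, ?_, ?_⟩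
  · rcases le_total g 0 with h | h
    · rw [max_eq_right h, max_eq_left (by linarith)]; ring
    · rw [max_eq_left h, max_eq_right (by linarith)]; ring
  · rcases h1.eq_or_lt with h | h
    · rw [h, sub_self, mul_zero]
    · rw [max_eq_right (h3 h), zero_mul]
  · rcases h2.eq_or_lt with h | h
    · rw [h, sub_self, mul_zero]
    · rw [max_eq_right (by linarith [h4 h]), zero_mul]

/-- The variational inequality expressed by the KKT conditions. -/
theorem BoxKKT.variational {g lo x hi : ℝ} (h : BoxKKT g lo x hi) {y : ℝ} (h1 : lo ≤ y)
    (h2 : y ≤ hi) : 0 ≤ g * (y - x) := by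
  obtain ⟨_, _, α, β, hα, hβ, hg, hα', hβ'⟩ := h
  have e : g * (y - x) = α * (y - lo) - α * (x - lo) + (β * (hi - y) - β * (hi - x)) := by
    rw [show g = α - β by linarith]; ring
  rw [e, hα', hβ']
  nlinarith [mul_nonneg hα (sub_nonneg.2 h1), mul_nonneg hβ (sub_nonneg.2 h2)]

theorem BoxKKT.nonpos_of_lt {g lo x hi : ℝ} (h : BoxKKT g lo x hi) (hx : lo < x) : g ≤ 0 := by
  by_contra! hg
  nlinarith [h.variational le_rfl (h.1.trans h.2.1)]

theorem BoxKKT.nonneg_of_lt {g lo x hi : ℝ} (h : BoxKKT g lo x hi) (hx : x < hi) : 0 ≤ g := by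
  by_contra! hg
  nlinarith [h.variational (h.1.trans h.2.1) le_rfl]

namespace PowerSystem

variable {Ω : Type*} [MeasurableSpace Ω] {P : Measure Ω}

theorem cUp_pos (S : PowerSystem P) : 0 < S.cUp := S.cF_pos.trans_le S.cF_le_cUp

/-! ### Recourse cost and balancing prices in one scenario -/

/-- The least re-dispatch cost when the forward position `x` has to be covered with stochastic
production `w` and an idle flexible unit. -/
noncomputable def recourseCost (S : PowerSystem P) (x w : ℝ) : ℝ :=
  S.cUp * max (x - w) 0 + (S.v - S.cUp) * max (x - w - S.capF) 0

/-- The right derivative of `recourseCost` in `x`: the largest supporting balancing price. -/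
noncomputable def scenarioPrice (S : PowerSystem P) (x w : ℝ) : ℝ :=
  (S.v - S.cUp) * (Set.Iic (x - S.capF)).indicator 1 w + S.cUp * (Set.Iic x).indicator 1 w

/-- The left derivative of `recourseCost` in `x`: for `x > 0`, the smallest supporting balancing
price. -/
noncomputable def leftScenarioPrice (S : PowerSystem P) (x w : ℝ) : ℝ :=
  (S.v - S.cUp) * (Set.Iio (x - S.capF)).indicator 1 w + S.cUp * (Set.Iio x).indicator 1 w

theorem max_sub_zero_subgradient_Iic (x y w : ℝ) :
    max (x - w) 0 + (Set.Iic x).indicator 1 w * (y - x) ≤ max (y - w) 0 := by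
  by_cases h : w ≤ x
  · rw [Set.indicator_of_mem (Set.mem_Iic.2 h), max_eq_left (by linarith), Pi.one_apply]
    exact le_max_of_le_left (by linarith)
  · rw [Set.indicator_of_notMem (by simpa using h), max_eq_right (by linarith)]
    simp

theorem max_sub_zero_subgradient_Iio (x y w : ℝ) :
    max (x - w) 0 + (Set.Iio x).indicator 1 w * (y - x) ≤ max (y - w) 0 := by
  by_cases h : w < x
  · rw [Set.indicator_of_mem (Set.mem_Iio.2 h), max_eq_left (by linarith), Pi.one_apply]
    exact le_max_of_le_left (by linarith)
  · rw [Set.indicator_of_notMem (by simpa using h), max_eq_right (by linarith)]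
    simp

theorem recourseCost_subgradient (S : PowerSystem P) (x y w : ℝ) :
    S.recourseCost x w + S.scenarioPrice x w * (y - x) ≤ S.recourseCost y w := by
  have h1 := mul_le_mul_of_nonneg_left (max_sub_zero_subgradient_Iic x y w) S.cUp_pos.le
  have h2 := mul_le_mul_of_nonneg_left
    (max_sub_zero_subgradient_Iic (x - S.capF) (y - S.capF) w) (sub_nonneg.2 S.cUp_lt_v.le)
  simp only [sub_right_comm _ S.capF w] at h2
  unfold recourseCost scenarioPrice
  linarith

theorem recourseCost_left_subgradient (S : PowerSystem P) (x y w : ℝ) :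
    S.recourseCost x w + S.leftScenarioPrice x w * (y - x) ≤ S.recourseCost y w := by
  have h1 := mul_le_mul_of_nonneg_left (max_sub_zero_subgradient_Iio x y w) S.cUp_pos.le
  have h2 := mul_le_mul_of_nonneg_left
    (max_sub_zero_subgradient_Iio (x - S.capF) (y - S.capF) w) (sub_nonneg.2 S.cUp_lt_v.le)
  simp only [sub_right_comm _ S.capF w] at h2
  unfold recourseCost leftScenarioPrice
  linarith

/-- No re-dispatch beats the merit order. Here `y` is the stochastic production used. -/
theorem recourseCost_le (S : PowerSystem P) {x w up y shed : ℝ} (hbal : up + y + shed = x)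
    (hup : 0 ≤ up) (hup' : up ≤ S.capF) (hy : y ≤ w) (hs : 0 ≤ shed) :
    S.recourseCost x w ≤ S.cUp * up + S.v * shed := by
  have h1 : max (x - w) 0 ≤ up + shed := max_le (by linarith) (by linarith)
  have h2 : max (x - w - S.capF) 0 ≤ shed := max_le (by linarith) hs
  unfold recourseCost
  linarith [mul_le_mul_of_nonneg_left h1 S.cUp_pos.le,
    mul_le_mul_of_nonneg_left h2 (sub_nonneg.2 S.cUp_lt_v.le)]

/-- The merit order is the only optimal re-dispatch. -/
theorem eq_meritOrder_of_cost_le (S : PowerSystem P) {x w up y shed : ℝ}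
    (hbal : up + y + shed = x)
    (hup : 0 ≤ up) (hup' : up ≤ S.capF) (hy : y ≤ w) (hs : 0 ≤ shed)
    (hc : S.cUp * up + S.v * shed ≤ S.recourseCost x w) :
    up = max (x - w) 0 - max (x - w - S.capF) 0 ∧ y = x - max (x - w) 0 ∧
      shed = max (x - w - S.capF) 0 := by
  have h1 : max (x - w) 0 ≤ up + shed := max_le (by linarith) (by linarith)
  have h2 : max (x - w - S.capF) 0 ≤ shed := max_le (by linarith) hs
  have h3 := S.cUp_pos
  have h4 := S.cUp_lt_v
  unfold recourseCost at hc
  have e1 : up + shed = max (x - w) 0 := by nlinarith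
  have e2 : shed = max (x - w - S.capF) 0 := by nlinarith
  exact ⟨by linarith, by linarith, e2⟩

/-- Every price between the one-sided derivatives of the recourse cost supports the merit order. -/
theorem boxKKT_meritOrder (S : PowerSystem P) {l x w lam : ℝ} (hx : 0 ≤ x) (hxl : x ≤ l)
    (hw : 0 ≤ w) (h1 : S.leftScenarioPrice x w ≤ lam) (h2 : lam ≤ S.scenarioPrice x w) :
    BoxKKT (S.cUp - lam) 0 (max (x - w) 0 - max (x - w - S.capF) 0) S.capF ∧
    BoxKKT (-lam) 0 (x - max (x - w) 0) w ∧
    BoxKKT (S.v - lam) 0 (max (x - w - S.capF) 0) l := by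
  have hU := S.cUp_pos
  have hv := S.cUp_lt_v
  have hF := S.capF_pos
  -- the consequences of the bounds on `lam`, segment by segment of the merit order
  have a1 : w < x → S.cUp ≤ lam := fun h => by
    refine le_trans ?_ h1
    unfold leftScenarioPrice
    rw [Set.indicator_of_mem (Set.mem_Iio.2 h)]
    have : 0 ≤ (Set.Iio (x - S.capF)).indicator (1 : ℝ → ℝ) w :=
      Set.indicator_nonneg (fun _ _ => zero_le_one) _
    simp only [Pi.one_apply]
    nlinarith
  have a2 : w < x - S.capF → S.v ≤ lam := fun h => by
    refine le_trans ?_ h1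
    unfold leftScenarioPrice
    rw [Set.indicator_of_mem (Set.mem_Iio.2 h), Set.indicator_of_mem (Set.mem_Iio.2 (by linarith))]
    simp
  have a3 : x < w → lam ≤ 0 := fun h => by
    refine h2.trans ?_
    unfold scenarioPrice
    rw [Set.indicator_of_notMem (by simp; linarith), Set.indicator_of_notMem (by simp; linarith)]
    simp
  have a4 : x - S.capF < w → lam ≤ S.cUp := fun h => by
    refine h2.trans ?_
    unfold scenarioPrice
    rw [Set.indicator_of_notMem (by simp; linarith)]
    have : (Set.Iic x).indicator (1 : ℝ → ℝ) w ≤ 1 :=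
      Set.indicator_le_self' (fun _ _ => zero_le_one) _
    nlinarith
  have a5 : 0 ≤ lam := by
    refine le_trans ?_ h1
    unfold leftScenarioPrice
    have h3 : 0 ≤ (Set.Iio (x - S.capF)).indicator (1 : ℝ → ℝ) w :=
      Set.indicator_nonneg (fun _ _ => zero_le_one) _
    have h4 : 0 ≤ (Set.Iio x).indicator (1 : ℝ → ℝ) w :=
      Set.indicator_nonneg (fun _ _ => zero_le_one) _
    nlinarith
  have a6 : lam ≤ S.v := by
    refine h2.trans ?_
    unfold scenarioPrice
    have h3 : (Set.Iic (x - S.capF)).indicator (1 : ℝ → ℝ) w ≤ 1 :=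
      Set.indicator_le_self' (fun _ _ => zero_le_one) _
    have h4 : (Set.Iic x).indicator (1 : ℝ → ℝ) w ≤ 1 :=
      Set.indicator_le_self' (fun _ _ => zero_le_one) _
    nlinarith
  rcases le_total (x - w) 0 with c1 | c1
  · rw [max_eq_right c1, max_eq_right (by linarith)]
    exact ⟨.of_sign (by linarith) (by linarith) (by intro; linarith)
        (fun _ => by linarith [a4 (by linarith)]),
      .of_sign (by linarith) (by linarith) (by intro; linarith)
        (fun h => by linarith [a3 (by linarith)]),
      .of_sign le_rfl (by linarith) (by intro; linarith) (by intro; linarith)⟩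
  · rw [max_eq_left c1]
    rcases le_total (x - w - S.capF) 0 with c2 | c2
    · rw [max_eq_right c2]
      exact ⟨.of_sign (by linarith) (by linarith) (fun h => by linarith [a1 (by linarith)])
          (fun h => by linarith [a4 (by linarith)]),
        .of_sign (by linarith) (by linarith) (by intro; linarith) (by intro; linarith),
        .of_sign le_rfl (by linarith) (by intro; linarith) (by intro; linarith)⟩
    · rw [max_eq_left c2]
      exact ⟨.of_sign (by linarith) (by linarith) (fun h => by linarith [a1 (by linarith)])
          (by intro; linarith),
        .of_sign (by linarith) (by linarith) (by intro; linarith) (by intro; linarith),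
        .of_sign (by linarith) (by linarith) (fun h => by linarith [a2 (by linarith)])
          (by intro; linarith)⟩

/-! ### Expected prices -/

/-- The expectation of `leftScenarioPrice x`, which is the left limit of `expectedPrice` at `x`. -/
noncomputable def leftPrice (S : PowerSystem P) (x : ℝ) : ℝ :=
  ∫ ω, S.leftScenarioPrice x (S.W ω) ∂P

theorem measurable_scenarioPrice (S : PowerSystem P) (x : ℝ) :
    Measurable fun ω => S.scenarioPrice x (S.W ω) :=
  (((measurable_one.indicator measurableSet_Iic).const_mul _).add
    ((measurable_one.indicator measurableSet_Iic).const_mul _)).comp S.measurable_W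

theorem measurable_leftScenarioPrice (S : PowerSystem P) (x : ℝ) :
    Measurable fun ω => S.leftScenarioPrice x (S.W ω) :=
  (((measurable_one.indicator measurableSet_Iio).const_mul _).add
    ((measurable_one.indicator measurableSet_Iio).const_mul _)).comp S.measurable_W

theorem norm_scenarioPrice_le (S : PowerSystem P) (x w : ℝ) : ‖S.scenarioPrice x w‖ ≤ S.v := by
  have hU := S.cUp_pos
  have hv := S.cUp_lt_v
  unfold scenarioPrice
  rw [Real.norm_eq_abs, abs_le]
  simp only [Set.indicator_apply, Pi.one_apply]
  split_ifs <;> constructor <;> linarith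

theorem norm_leftScenarioPrice_le (S : PowerSystem P) (x w : ℝ) :
    ‖S.leftScenarioPrice x w‖ ≤ S.v := by
  have hU := S.cUp_pos
  have hv := S.cUp_lt_v
  unfold leftScenarioPrice
  rw [Real.norm_eq_abs, abs_le]
  simp only [Set.indicator_apply, Pi.one_apply]
  split_ifs <;> constructor <;> linarith

theorem leftScenarioPrice_le (S : PowerSystem P) (x w : ℝ) :
    S.leftScenarioPrice x w ≤ S.scenarioPrice x w := by
  have h (a : ℝ) : (Set.Iio a).indicator (1 : ℝ → ℝ) w ≤ (Set.Iic a).indicator 1 w :=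
    Set.indicator_le_indicator_of_subset Set.Iio_subset_Iic_self (fun _ => zero_le_one) w
  exact add_le_add (mul_le_mul_of_nonneg_left (h _) (sub_nonneg.2 S.cUp_lt_v.le))
    (mul_le_mul_of_nonneg_left (h _) S.cUp_pos.le)

theorem integrable_scenarioPrice [IsProbabilityMeasure P] (S : PowerSystem P) (x : ℝ) :
    Integrable (fun ω => S.scenarioPrice x (S.W ω)) P :=
  .of_bound (S.measurable_scenarioPrice x).aestronglyMeasurable S.v
    (.of_forall fun _ => S.norm_scenarioPrice_le _ _)

theorem integrable_leftScenarioPrice [IsProbabilityMeasure P] (S : PowerSystem P) (x : ℝ) :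
    Integrable (fun ω => S.leftScenarioPrice x (S.W ω)) P :=
  .of_bound (S.measurable_leftScenarioPrice x).aestronglyMeasurable S.v
    (.of_forall fun _ => S.norm_leftScenarioPrice_le _ _)

theorem cdfW_eq [IsProbabilityMeasure P] (S : PowerSystem P) (x : ℝ) :
    S.cdfW x = P.real (S.W ⁻¹' Set.Iic x) := by
  have := Measure.isProbabilityMeasure_map (μ := P) S.measurable_W.aemeasurable
  rw [cdfW, ProbabilityTheory.cdf_eq_real,
    map_measureReal_apply S.measurable_W measurableSet_Iic]

theorem expectedPrice_eq_integral [IsProbabilityMeasure P] (S : PowerSystem P) (x : ℝ) :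
    S.expectedPrice x = ∫ ω, S.scenarioPrice x (S.W ω) ∂P := by
  have hm (a : ℝ) : MeasurableSet (S.W ⁻¹' Set.Iic a) := S.measurable_W measurableSet_Iic
  have hi (a : ℝ) : Integrable ((S.W ⁻¹' Set.Iic a).indicator (1 : Ω → ℝ)) P :=
    (integrable_const (1 : ℝ)).indicator (hm a)
  have e : (fun ω => S.scenarioPrice x (S.W ω)) = fun ω =>
      (S.v - S.cUp) * (S.W ⁻¹' Set.Iic (x - S.capF)).indicator 1 ω +
        S.cUp * (S.W ⁻¹' Set.Iic x).indicator 1 ω := rfl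
  rw [e, integral_add ((hi _).const_mul _) ((hi _).const_mul _), integral_const_mul,
    integral_const_mul, integral_indicator_one (hm _), integral_indicator_one (hm _),
    expectedPrice, cdfW_eq, cdfW_eq]

theorem expectedPrice_mono (S : PowerSystem P) : Monotone S.expectedPrice := fun x y h => by
  have h1 : S.cdfW (x - S.capF) ≤ S.cdfW (y - S.capF) :=
    ProbabilityTheory.monotone_cdf _ (by linarith)
  have h2 : S.cdfW x ≤ S.cdfW y := ProbabilityTheory.monotone_cdf _ h
  exact add_le_add (mul_le_mul_of_nonneg_left h1 (sub_nonneg.2 S.cUp_lt_v.le))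
    (mul_le_mul_of_nonneg_left h2 S.cUp_pos.le)

theorem tendsto_indicator_Iic_left (w a c : ℝ) :
    Tendsto (fun y => (Set.Iic (y - c)).indicator (1 : ℝ → ℝ) w) (𝓝[<] a)
      (𝓝 ((Set.Iio (a - c)).indicator 1 w)) := by
  refine tendsto_const_nhds.congr' ?_
  by_cases h : w < a - c
  · have : ∀ᶠ y in 𝓝[<] a, w + c < y :=
      nhdsWithin_le_nhds (lt_mem_nhds (by linarith))
    filter_upwards [this] with y hy
    rw [Set.indicator_of_mem (Set.mem_Iio.2 h), Set.indicator_of_mem (Set.mem_Iic.2 (by linarith))]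
  · filter_upwards [self_mem_nhdsWithin] with y hy
    have hy : y < a := hy
    rw [Set.indicator_of_notMem (by simpa using h),
      Set.indicator_of_notMem (by rw [Set.mem_Iic]; linarith)]

theorem tendsto_indicator_Iic_right (w a c : ℝ) :
    Tendsto (fun y => (Set.Iic (y - c)).indicator (1 : ℝ → ℝ) w) (𝓝[>] a)
      (𝓝 ((Set.Iic (a - c)).indicator 1 w)) := by
  refine tendsto_const_nhds.congr' ?_
  by_cases h : w ≤ a - c
  · filter_upwards [self_mem_nhdsWithin] with y hy
    have hy : a < y := hy
    rw [Set.indicator_of_mem (Set.mem_Iic.2 h), Set.indicator_of_mem (Set.mem_Iic.2 (by linarith))]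
  · have : ∀ᶠ y in 𝓝[>] a, y < w + c :=
      nhdsWithin_le_nhds (gt_mem_nhds (by linarith))
    filter_upwards [this] with y hy
    rw [Set.indicator_of_notMem (by simpa using h),
      Set.indicator_of_notMem (by rw [Set.mem_Iic]; linarith)]

theorem tendsto_expectedPrice_left [IsProbabilityMeasure P] (S : PowerSystem P) (x : ℝ) :
    Tendsto S.expectedPrice (𝓝[<] x) (𝓝 (S.leftPrice x)) := by
  simp only [funext S.expectedPrice_eq_integral]
  refine tendsto_integral_filter_of_dominated_convergence (fun _ => S.v)
    (.of_forall fun y => (S.measurable_scenarioPrice y).aestronglyMeasurable)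
    (.of_forall fun _ => .of_forall fun _ => S.norm_scenarioPrice_le _ _) (integrable_const _)
    (.of_forall fun ω => ?_)
  have h := tendsto_indicator_Iic_left (S.W ω) x 0
  simp only [sub_zero] at h
  exact ((tendsto_indicator_Iic_left _ _ _).const_mul _).add (h.const_mul _)

theorem tendsto_expectedPrice_right [IsProbabilityMeasure P] (S : PowerSystem P) (x : ℝ) :
    Tendsto S.expectedPrice (𝓝[>] x) (𝓝 (S.expectedPrice x)) := by
  simp only [funext S.expectedPrice_eq_integral]
  refine tendsto_integral_filter_of_dominated_convergence (fun _ => S.v)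
    (.of_forall fun y => (S.measurable_scenarioPrice y).aestronglyMeasurable)
    (.of_forall fun _ => .of_forall fun _ => S.norm_scenarioPrice_le _ _) (integrable_const _)
    (.of_forall fun ω => ?_)
  have h := tendsto_indicator_Iic_right (S.W ω) x 0
  simp only [sub_zero] at h
  exact ((tendsto_indicator_Iic_right _ _ _).const_mul _).add (h.const_mul _)

theorem leftPrice_nonneg (S : PowerSystem P) (x : ℝ) : 0 ≤ S.leftPrice x :=
  integral_nonneg fun _ => add_nonneg
    (mul_nonneg (sub_nonneg.2 S.cUp_lt_v.le) (Set.indicator_nonneg (fun _ _ => zero_le_one) _))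
    (mul_nonneg S.cUp_pos.le (Set.indicator_nonneg (fun _ _ => zero_le_one) _))

theorem leftPrice_zero (S : PowerSystem P) : S.leftPrice 0 = 0 := by
  refine integral_eq_zero_of_ae ?_
  filter_upwards [S.W_mem] with ω hω
  have := S.capF_pos
  rw [leftScenarioPrice, Set.indicator_of_notMem (by rw [Set.mem_Iio]; linarith),
    Set.indicator_of_notMem (by rw [Set.mem_Iio]; linarith)]
  simp

theorem leftPrice_le [IsProbabilityMeasure P] (S : PowerSystem P) {x c : ℝ} (hx : 0 ≤ x)
    (hc : 0 ≤ c) (h : ∀ y, 0 ≤ y → y < x → S.expectedPrice y ≤ c) : S.leftPrice x ≤ c := by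
  rcases hx.eq_or_lt with rfl | hx
  · rwa [leftPrice_zero]
  · refine le_of_tendsto (S.tendsto_expectedPrice_left x) ?_
    filter_upwards [self_mem_nhdsWithin, nhdsWithin_le_nhds (lt_mem_nhds hx)] with y h1 h2
    exact h y h2.le h1

theorem le_expectedPrice [IsProbabilityMeasure P] (S : PowerSystem P) {x z c : ℝ} (hz : x < z)
    (h : ∀ y, x < y → y ≤ z → c ≤ S.expectedPrice y) : c ≤ S.expectedPrice x := by
  refine ge_of_tendsto (S.tendsto_expectedPrice_right x) ?_
  filter_upwards [self_mem_nhdsWithin, nhdsWithin_le_nhds (gt_mem_nhds hz)] with y h1 h2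
  exact h y h1 h2.le

theorem cUp_le_expectedPrice_capW [IsProbabilityMeasure P] (S : PowerSystem P) :
    S.cUp ≤ S.expectedPrice S.capW := by
  have h1 : S.cdfW S.capW = 1 := by
    have h : S.W ⁻¹' Set.Iic S.capW ∈ ae P := by
      filter_upwards [S.W_mem] with ω hω using hω.2
    rw [cdfW_eq, measureReal_def,
      (mem_ae_iff_prob_eq_one (S.measurable_W measurableSet_Iic)).1 h, ENNReal.toReal_one]
  have h2 : 0 ≤ S.cdfW (S.capW - S.capF) := ProbabilityTheory.cdf_nonneg _ _
  have h3 := S.cUp_lt_v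
  rw [expectedPrice, h1]
  nlinarith

theorem isLeast_l2 [IsProbabilityMeasure P] (S : PowerSystem P) (hc : S.cI < S.cF) :
    IsLeast S.l2Set S.l2 ∧ S.l2 ≤ S.capW := by
  have hne : S.capW ∈ S.l2Set :=
    ⟨S.capW_pos.le, by linarith [S.cUp_le_expectedPrice_capW, S.cF_le_cUp]⟩
  have hb : BddBelow S.l2Set := ⟨0, fun x hx => hx.1⟩
  refine ⟨⟨⟨le_csInf ⟨_, hne⟩ fun x hx => hx.1, ?_⟩, fun x hx => csInf_le hb hx⟩, csInf_le hb hne⟩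
  refine S.le_expectedPrice (lt_add_one _) fun y hy _ => ?_
  obtain ⟨z, hz, hzy⟩ := exists_lt_of_csInf_lt ⟨_, hne⟩ hy
  exact hz.2.trans (S.expectedPrice_mono hzy.le)

/-! ### The reduced problem in the forward position -/

/-- The expected cost as a function of the forward position `x` of the stochastic production, with
`p_F = 0`, `p_I = l - x` and merit-order re-dispatch. -/
noncomputable def reducedCost (S : PowerSystem P) (l x : ℝ) : ℝ :=
  S.cI * (l - x) + ∫ ω, S.recourseCost x (S.W ω) ∂P

/-- `x` minimizes `reducedCost` over the interval from `0` to `min l p̄_W`. -/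
def IsMinimizer (S : PowerSystem P) (l x : ℝ) : Prop :=
  (0 ≤ x ∧ x ≤ l ∧ x ≤ S.capW) ∧
    ∀ y, 0 ≤ y → y ≤ l → y ≤ S.capW → S.reducedCost l x ≤ S.reducedCost l y

theorem integrable_recourseCost [IsProbabilityMeasure P] (S : PowerSystem P) (x : ℝ) :
    Integrable (fun ω => S.recourseCost x (S.W ω)) P := by
  have hW : Integrable S.W P := .of_bound S.measurable_W.aestronglyMeasurable S.capW (by
    filter_upwards [S.W_mem] with ω hω
    rw [Real.norm_eq_abs, abs_of_nonneg hω.1]; exact hω.2)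
  have h1 : Integrable (fun ω => x - S.W ω) P := (integrable_const _).sub hW
  have h2 : Integrable (fun ω => x - S.W ω - S.capF) P := h1.sub (integrable_const _)
  exact (h1.pos_part.const_mul _).add (h2.pos_part.const_mul _)

theorem reducedCost_subgradient [IsProbabilityMeasure P] (S : PowerSystem P) (l x y : ℝ) :
    S.reducedCost l x + (S.expectedPrice x - S.cI) * (y - x) ≤ S.reducedCost l y := by
  have h := integral_mono
    ((S.integrable_recourseCost x).add ((S.integrable_scenarioPrice x).mul_const (y - x)))
    (S.integrable_recourseCost y) fun ω => S.recourseCost_subgradient x y (S.W ω)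
  simp only [Pi.add_apply] at h
  rw [integral_add (S.integrable_recourseCost x) ((S.integrable_scenarioPrice x).mul_const _),
    integral_mul_const, ← S.expectedPrice_eq_integral] at h
  unfold reducedCost
  linarith

theorem reducedCost_left_subgradient [IsProbabilityMeasure P] (S : PowerSystem P) (l x y : ℝ) :
    S.reducedCost l x + (S.leftPrice x - S.cI) * (y - x) ≤ S.reducedCost l y := by
  have h := integral_mono
    ((S.integrable_recourseCost x).add ((S.integrable_leftScenarioPrice x).mul_const (y - x)))
    (S.integrable_recourseCost y) fun ω => S.recourseCost_left_subgradient x y (S.W ω)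
  simp only [Pi.add_apply] at h
  rw [integral_add (S.integrable_recourseCost x) ((S.integrable_leftScenarioPrice x).mul_const _),
    integral_mul_const] at h
  unfold reducedCost leftPrice
  linarith

/-- To the left of a minimizer the expected price is at most `c_I`. -/
theorem IsMinimizer.expectedPrice_le [IsProbabilityMeasure P] {S : PowerSystem P} {l x y : ℝ}
    (h : S.IsMinimizer l x) (hy : 0 ≤ y) (hyx : y < x) : S.expectedPrice y ≤ S.cI := by
  by_contra! hlt
  obtain ⟨⟨_, h2, h3⟩, h4⟩ := h
  nlinarith [h4 y hy (by linarith) (by linarith), S.reducedCost_subgradient l y x]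

/-- The first-order conditions for the convex function `reducedCost`. At `x = p̄_W < l` the second
condition carries no information about minimality; it holds because `c_I < c_F⁺`. -/
theorem isMinimizer_iff [IsProbabilityMeasure P] (S : PowerSystem P) (hc : S.cI < S.cF)
    {l x : ℝ} : S.IsMinimizer l x ↔ (0 ≤ x ∧ x ≤ l ∧ x ≤ S.capW) ∧ S.leftPrice x ≤ S.cI ∧
      (x < l → S.cI ≤ S.expectedPrice x) := by
  constructor
  · intro h
    refine ⟨h.1, S.leftPrice_le h.1.1 S.cI_pos.le fun y => h.expectedPrice_le, fun hxl => ?_⟩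
    obtain ⟨⟨h1, h2, h3⟩, h4⟩ := h
    rcases h3.eq_or_lt with rfl | h3
    · linarith [S.cUp_le_expectedPrice_capW, S.cF_le_cUp]
    · refine S.le_expectedPrice (lt_min hxl h3) fun y hy hym => ?_
      by_contra! hlt
      nlinarith [h4 y (by linarith) (hym.trans (min_le_left _ _)) (hym.trans (min_le_right _ _)),
        S.reducedCost_subgradient l y x]
  · rintro ⟨h1, h2, h3⟩
    refine ⟨h1, fun y _ hy _ => ?_⟩
    rcases le_or_gt y x with hyx | hyx
    · nlinarith [S.reducedCost_left_subgradient l x y]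
    · nlinarith [S.reducedCost_subgradient l x y, h3 (hyx.trans_le hy)]

theorem isMinimizer_of_le_l2 [IsProbabilityMeasure P] (S : PowerSystem P) (hc : S.cI < S.cF)
    {l x : ℝ} (hx : 0 ≤ x) (hxl : x ≤ l) (hx2 : x ≤ S.l2) (h : x < l → x = S.l2) :
    S.IsMinimizer l x := by
  obtain ⟨hl2, hcap⟩ := S.isLeast_l2 hc
  refine (S.isMinimizer_iff hc).2 ⟨⟨hx, hxl, hx2.trans hcap⟩,
    S.leftPrice_le hx S.cI_pos.le fun y hy hyx => ?_, fun hlt => ?_⟩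
  · by_contra! hlt
    linarith [hl2.2 ⟨hy, hlt.le⟩]
  · rw [h hlt]
    exact hl2.1.2

/-! ### The bilevel problem -/

theorem lowerOptimal_iff (S : PowerSystem P) (hc : S.cI < S.cF) {l pW pF pI : ℝ}
    (hI : l ≤ S.capI) (hpW : 0 ≤ pW) :
    S.LowerOptimal l pW pF pI ↔ pF = 0 ∧ pI = l - pW ∧ pW ≤ l := by
  constructor
  · rintro ⟨⟨h1, h2, h3, h4, h5⟩, h⟩
    have := h 0 (l - pW) ⟨by ring, le_rfl, S.capF_pos.le, by linarith, by linarith⟩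
    rw [show l - pW = pF + pI by linarith] at this
    have : pF = 0 := by nlinarith
    exact ⟨this, by linarith, by linarith⟩
  · rintro ⟨rfl, rfl, h⟩
    refine ⟨⟨by ring, le_rfl, S.capF_pos.le, by linarith, by linarith⟩, ?_⟩
    rintro xF xI ⟨h1, h2, h3, h4, h5⟩
    rw [show l - pW = xF + xI by linarith]
    nlinarith

/-- The re-dispatch that covers the forward position `x` by stochastic production, flexible unit and
load shedding, in this order. -/
noncomputable def meritOrder (S : PowerSystem P) (x : ℝ) : Redispatch Ω where
  up ω := max (x - S.W ω) 0 - max (x - S.W ω - S.capF) 0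
  dn _ := 0
  dW ω := -max (x - S.W ω) 0
  shed ω := max (x - S.W ω - S.capF) 0

theorem isMeasurable_meritOrder (S : PowerSystem P) (x : ℝ) : (S.meritOrder x).IsMeasurable := by
  have h1 : Measurable fun ω => max (x - S.W ω) 0 :=
    (S.measurable_W.const_sub x).max measurable_const
  have h2 : Measurable fun ω => max (x - S.W ω - S.capF) 0 :=
    ((S.measurable_W.const_sub x).sub_const _).max measurable_const
  exact ⟨h1.sub h2, measurable_const, h1.neg, h2⟩

/-- Pointwise agreement of a re-dispatch with the merit order in the scenario `ω`. -/
def AgreesAt (r q : Redispatch Ω) (ω : Ω) : Prop :=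
  r.up ω = q.up ω ∧ r.dn ω = q.dn ω ∧ r.dW ω = q.dW ω ∧ r.shed ω = q.shed ω

/-- A re-dispatch that agrees almost surely with the merit order is feasible, and its expected cost
is the reduced cost. -/
theorem bilevelFeasible_of_agreesAt (S : PowerSystem P) (hc : S.cI < S.cF)
    {l x : ℝ} (hI : l ≤ S.capI) (hx : 0 ≤ x ∧ x ≤ l ∧ x ≤ S.capW) {r : Redispatch Ω}
    (hm : r.IsMeasurable) (hr : ∀ᵐ ω ∂P, AgreesAt r (S.meritOrder x) ω) :
    S.BilevelFeasible l ⟨0, l - x, x⟩ r ∧ S.expectedCost ⟨0, l - x, x⟩ r = S.reducedCost l x := by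
  constructor
  · refine ⟨hm, hx.1, hx.2.2, ?_, (S.lowerOptimal_iff hc hI hx.1).2 ⟨rfl, rfl, hx.2.1⟩⟩
    filter_upwards [hr, S.W_mem] with ω ⟨h1, h2, h3, h4⟩ hw
    have hF := S.capF_pos
    rw [h1, h2, h3, h4]
    simp only [meritOrder]
    rcases max_cases (x - S.W ω) 0 with ⟨e1, c1⟩ | ⟨e1, c1⟩ <;>
      rcases max_cases (x - S.W ω - S.capF) 0 with ⟨e2, c2⟩ | ⟨e2, c2⟩ <;>
      rw [e1, e2] <;> refine ⟨by ring, ⟨?_, ?_⟩, ⟨?_, ?_⟩, ⟨?_, ?_⟩, ?_, ?_⟩ <;> linarith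
  · unfold expectedCost reducedCost
    have : ∫ ω, (S.cUp * r.up ω - S.cDn * r.dn ω + S.v * r.shed ω) ∂P =
        ∫ ω, S.recourseCost x (S.W ω) ∂P := by
      refine integral_congr_ae ?_
      filter_upwards [hr] with ω ⟨h1, h2, h3, h4⟩
      rw [h1, h2, h4]
      simp only [meritOrder, recourseCost]
      ring
    rw [this]
    ring

theorem BilevelFeasible.integrable_cost [IsProbabilityMeasure P] {S : PowerSystem P} {l : ℝ}
    {d : ForwardDispatch} {r : Redispatch Ω} (h : S.BilevelFeasible l d r) :
    Integrable (fun ω => S.cUp * r.up ω - S.cDn * r.dn ω + S.v * r.shed ω) P := by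
  obtain ⟨⟨m1, m2, _, m4⟩, _, _, hae, _⟩ := h
  have i1 : Integrable r.up P := .of_bound m1.aestronglyMeasurable (S.capF - d.pF) (by
    filter_upwards [hae] with ω hω
    rw [Real.norm_eq_abs, abs_of_nonneg hω.2.1.1]; exact hω.2.1.2)
  have i2 : Integrable r.dn P := .of_bound m2.aestronglyMeasurable d.pF (by
    filter_upwards [hae] with ω hω
    rw [Real.norm_eq_abs, abs_of_nonneg hω.2.2.1.1]; exact hω.2.2.1.2)
  have i4 : Integrable r.shed P := .of_bound m4.aestronglyMeasurable l (by
    filter_upwards [hae] with ω hω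
    rw [Real.norm_eq_abs, abs_of_nonneg hω.2.2.2.2.1]; exact hω.2.2.2.2.2)
  exact ((i1.const_mul _).sub (i2.const_mul _)).add (i4.const_mul _)

/-- The bilevel problem reduces to the minimization of `reducedCost`: its solutions are the
minimizers combined with an almost surely unique re-dispatch. -/
theorem mem_bilevelSolutions_iff [IsProbabilityMeasure P] (S : PowerSystem P) (hc : S.cI < S.cF)
    {l : ℝ} (hI : l ≤ S.capI) (d : ForwardDispatch) (r : Redispatch Ω) :
    (d, r) ∈ S.bilevelSolutions l ↔ d = ⟨0, l - d.pW, d.pW⟩ ∧ S.IsMinimizer l d.pW ∧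
      r.IsMeasurable ∧ ∀ᵐ ω ∂P, AgreesAt r (S.meritOrder d.pW) ω := by
  -- a feasible point costs at least the reduced cost, scenario by scenario
  have key : ∀ d r, S.BilevelFeasible l d r → d = ⟨0, l - d.pW, d.pW⟩ ∧
      (0 ≤ d.pW ∧ d.pW ≤ l ∧ d.pW ≤ S.capW) ∧ r.IsMeasurable ∧
      (∀ᵐ ω ∂P, r.dn ω = 0 ∧ S.recourseCost d.pW (S.W ω) ≤ S.cUp * r.up ω + S.v * r.shed ω ∧
        (S.cUp * r.up ω + S.v * r.shed ω ≤ S.recourseCost d.pW (S.W ω) →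
          AgreesAt r (S.meritOrder d.pW) ω)) := by
    rintro ⟨pF, pI, x⟩ r ⟨hm, h0, hcap, hae, hlow⟩
    obtain ⟨hF, hpI, hle⟩ := (S.lowerOptimal_iff hc hI h0).1 hlow
    dsimp only at hF hpI hle h0 hcap hae ⊢
    subst hF hpI
    refine ⟨rfl, ⟨h0, hle, hcap⟩, hm, ?_⟩
    filter_upwards [hae] with ω ⟨hb, ⟨u1, u2⟩, ⟨d1, d2⟩, ⟨y1, y2⟩, s1, s2⟩
    have hdn : r.dn ω = 0 := le_antisymm d2 d1
    have hb' : r.up ω + (x + r.dW ω) + r.shed ω = x := by linarith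
    refine ⟨hdn, S.recourseCost_le hb' u1 (by linarith) y2 s1, fun hcost => ?_⟩
    obtain ⟨e1, e2, e3⟩ := S.eq_meritOrder_of_cost_le hb' u1 (by linarith) y2 s1 hcost
    exact ⟨e1, hdn, by simp only [meritOrder]; linarith, e3⟩
  have hcost : ∀ d r, S.BilevelFeasible l d r → S.reducedCost l d.pW ≤ S.expectedCost d r ∧
      (S.expectedCost d r ≤ S.reducedCost l d.pW →
        ∀ᵐ ω ∂P, AgreesAt r (S.meritOrder d.pW) ω) := by
    intro d r hf
    obtain ⟨hd, hx, hm, hae⟩ := key d r hf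
    have hi := hf.integrable_cost
    have e1 : d.pF = 0 := congrArg ForwardDispatch.pF hd
    have e2 : d.pI = l - d.pW := congrArg ForwardDispatch.pI hd
    have hnn : 0 ≤ᵐ[P] fun ω => (S.cUp * r.up ω - S.cDn * r.dn ω + S.v * r.shed ω) -
        S.recourseCost d.pW (S.W ω) := by
      filter_upwards [hae] with ω hω
      have := hω.2.1
      rw [hω.1]
      simp only [Pi.zero_apply]
      linarith
    have hint := integral_sub hi (S.integrable_recourseCost d.pW)
    have h0 := integral_nonneg_of_ae hnn
    unfold expectedCost reducedCost
    rw [e1, e2]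
    refine ⟨by linarith, fun hle => ?_⟩
    have hz := (integral_eq_zero_iff_of_nonneg_ae hnn
      (hi.sub (S.integrable_recourseCost d.pW))).1 (by linarith)
    filter_upwards [hz, hae] with ω hω hω'
    refine hω'.2.2 ?_
    rw [hω'.1] at hω
    simp only [Pi.zero_apply] at hω
    linarith
  constructor
  · rintro ⟨hf, hopt⟩
    dsimp only at hf hopt
    obtain ⟨hd, hx, hm, hae⟩ := key d r hf
    have hopt' : ∀ y, 0 ≤ y → y ≤ l → y ≤ S.capW → S.expectedCost d r ≤ S.reducedCost l y := by
      intro y h1 h2 h3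
      obtain ⟨hf', hc'⟩ := S.bilevelFeasible_of_agreesAt hc hI ⟨h1, h2, h3⟩
        (S.isMeasurable_meritOrder y) (.of_forall fun ω => ⟨rfl, rfl, rfl, rfl⟩)
      exact (hopt _ _ hf').trans_eq hc'
    exact ⟨hd, ⟨hx, fun y h1 h2 h3 => (hcost d r hf).1.trans (hopt' y h1 h2 h3)⟩, hm,
      (hcost d r hf).2 (hopt' _ hx.1 hx.2.1 hx.2.2)⟩
  · rintro ⟨hd, ⟨hx, hmin⟩, hm, hae⟩
    obtain ⟨hf, hcst⟩ := S.bilevelFeasible_of_agreesAt hc hI hx hm hae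
    rw [← hd] at hf hcst
    refine ⟨hf, fun d' r' hf' => ?_⟩
    obtain ⟨_, hx', _⟩ := key d' r' hf'
    dsimp only
    rw [hcst]
    exact (hmin _ hx'.1 hx'.2.1 hx'.2.2).trans (hcost d' r' hf').1

theorem mem_bilevelSolutions_of_isMinimizer [IsProbabilityMeasure P] (S : PowerSystem P)
    (hc : S.cI < S.cF) {l x : ℝ} (hI : l ≤ S.capI) (h : S.IsMinimizer l x) :
    ((⟨0, l - x, x⟩ : ForwardDispatch), S.meritOrder x) ∈ S.bilevelSolutions l :=
  (S.mem_bilevelSolutions_iff hc hI _ _).2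
    ⟨rfl, h, S.isMeasurable_meritOrder x, .of_forall fun _ => ⟨rfl, rfl, rfl, rfl⟩⟩

/-! ### Virtual-bidding equilibria -/

/-- Balancing prices that support the merit order at a minimizer, with an expectation that supports
the forward dispatch. -/
theorem IsMinimizer.exists_price [IsProbabilityMeasure P] {S : PowerSystem P} (hc : S.cI < S.cF)
    {l x : ℝ} (h : S.IsMinimizer l x) :
    ∃ lam : Ω → ℝ, Integrable lam P ∧
      (∀ ω, S.leftScenarioPrice x (S.W ω) ≤ lam ω ∧ lam ω ≤ S.scenarioPrice x (S.W ω)) ∧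
      0 ≤ ∫ ω, lam ω ∂P ∧ ∫ ω, lam ω ∂P ≤ S.cI ∧ (x < l → ∫ ω, lam ω ∂P = S.cI) := by
  obtain ⟨⟨_, hxl, _⟩, h1, h2⟩ := (S.isMinimizer_iff hc).1 h
  rcases hxl.eq_or_lt with rfl | hxl
  · exact ⟨_, S.integrable_leftScenarioPrice x, fun ω => ⟨le_rfl, S.leftScenarioPrice_le _ _⟩,
      S.leftPrice_nonneg x, h1, fun h => absurd h (lt_irrefl _)⟩
  · have hmem : S.cI ∈ segment ℝ (S.leftPrice x) (S.expectedPrice x) := by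
      rw [segment_eq_Icc (h1.trans (h2 hxl))]
      exact ⟨h1, h2 hxl⟩
    obtain ⟨a, b, ha, hb, hab, he⟩ := hmem
    simp only [smul_eq_mul] at he
    have i1 := (S.integrable_leftScenarioPrice x).const_mul a
    have i2 := (S.integrable_scenarioPrice x).const_mul b
    have hint : ∫ ω, (a * S.leftScenarioPrice x (S.W ω) + b * S.scenarioPrice x (S.W ω)) ∂P
        = S.cI := by
      rw [integral_add i1 i2, integral_const_mul, integral_const_mul,
        ← S.expectedPrice_eq_integral]
      exact he
    refine ⟨_, i1.add i2, fun ω => ?_, ?_, ?_, fun _ => hint⟩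
    · have := S.leftScenarioPrice_le x (S.W ω)
      obtain rfl : a = 1 - b := by linarith
      simp only [Pi.add_apply]
      constructor <;> nlinarith
    · exact S.cI_pos.le.trans_eq hint.symm
    · exact hint.le

theorem bilevelSolutions_subset [IsProbabilityMeasure P] (S : PowerSystem P) (hc : S.cI < S.cF)
    {l pHat : ℝ} (hI : l ≤ S.capI) (hHat : 0 ≤ pHat) :
    S.bilevelSolutions l ⊆ S.equilibriumSolutions l pHat := by
  rintro ⟨d, r⟩ hx
  obtain ⟨hd, hmin, hm, hae⟩ := (S.mem_bilevelSolutions_iff hc hI d r).1 hx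
  obtain ⟨lam, hi, hlam, h0, hle, heq⟩ := hmin.exists_price hc
  obtain ⟨hx0, hxl, hxW⟩ := hmin.1
  generalize d.pW = x at *
  -- the stochastic producer sells `pHat`, the virtual bidder makes up the difference to `x`
  refine ⟨⟨0, l - x, pHat⟩, ⟨r.up, r.dn, fun ω => r.dW ω + (x - pHat), r.shed⟩, x - pHat,
    fun _ => -(x - pHat), ∫ ω, lam ω ∂P, lam, ⟨⟨hm.1, hm.2.1, hm.2.2.1.add_const _, hm.2.2.2⟩,
    measurable_const, hi, ⟨by ring, ?_, ?_, ?_⟩, ?_, ?_⟩, ?_⟩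
  · exact .of_sign le_rfl S.capF_pos.le (fun h => absurd h (lt_irrefl _)) (fun _ => by linarith)
  · exact .of_sign (by linarith) (by linarith)
      (fun h => by linarith [heq (by linarith)]) (fun _ => by linarith)
  · exact .of_sign hHat le_rfl (fun _ => by linarith) (fun h => absurd h (lt_irrefl _))
  · filter_upwards [hae, S.W_mem] with ω ⟨e1, e2, e3, e4⟩ hw
    obtain ⟨k1, k2, k3⟩ := S.boxKKT_meritOrder hx0 hxl hw.1 (hlam ω).1 (hlam ω).2
    unfold BalancingKKT
    dsimp only
    rw [e1, e2, e3, e4]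
    dsimp only [meritOrder]
    refine ⟨by ring, by rwa [sub_zero], ?_, ?_, k3⟩
    · exact .of_sign le_rfl le_rfl (fun h => absurd h (lt_irrefl _)) (fun h => absurd h (lt_irrefl _))
    · exact .of_sign (by linarith [k2.1]) (by linarith [k2.2.1])
        (fun h => k2.nonpos_of_lt (by linarith)) (fun h => k2.nonneg_of_lt (by linarith))
  · exact ⟨.of_forall fun _ => by ring, lam, hi, sub_self _, .of_forall fun _ => sub_self _⟩
  · refine Prod.ext (hd.trans ?_) ?_
    · dsimp only
      congr 1
      ring
    · dsimp only
      simp only [add_neg_cancel_right]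

/-- In an equilibrium the flexible unit is not dispatched in the forward market. -/
theorem IsEquilibrium.pF_eq_zero [IsProbabilityMeasure P] {S : PowerSystem P} (hc : S.cI < S.cF)
    (hW : ¬ (∀ᵐ ω ∂P, S.W ω = 0)) {l pHat : ℝ} (hI : l ≤ S.capI) {d : ForwardDispatch}
    {r : Redispatch Ω} {pV : ℝ} {dV : Ω → ℝ} {lamF : ℝ} {lamB : Ω → ℝ} (hlam : ∫ ω, lamB ω ∂P = lamF)
    (h : S.IsEquilibrium l pHat d r pV dV lamF lamB) : d.pF = 0 := by
  obtain ⟨_, _, hi, ⟨hbal, kF, kI, kW⟩, hB, hV, _⟩ := h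
  by_contra hne
  have hpos : 0 < d.pF := lt_of_le_of_ne kF.1 (Ne.symm hne)
  have hlF : S.cF ≤ lamF := by linarith [kF.nonpos_of_lt hpos]
  have hpI : S.capI ≤ d.pI := by
    by_contra! hlt
    linarith [kI.nonneg_of_lt hlt]
  have hcDn := S.cDn_le_cF
  have hcF := S.cF_pos
  -- the negative net position forces downward regulation in every scenario
  have hdn : ∀ᵐ ω ∂P, lamB ω ≤ S.cDn := by
    filter_upwards [hB, hV] with ω ⟨b, ku, kd, kw, ks⟩ hv
    have : 0 < r.dn ω := by linarith [ku.1, kw.1, ks.1]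
    linarith [kd.nonpos_of_lt this]
  -- as the mean price is at least `c_F ≥ c_F⁻`, the balancing price is `c_F⁻ = c_F` almost surely
  have hnn : 0 ≤ᵐ[P] fun ω => S.cDn - lamB ω := by
    filter_upwards [hdn] with ω hω
    simpa using hω
  have hint : ∫ ω, (S.cDn - lamB ω) ∂P = S.cDn - lamF := by
    rw [integral_sub (integrable_const _) hi, hlam]; simp
  have h0 := integral_nonneg_of_ae hnn
  rw [hint] at h0
  have hz := (integral_eq_zero_iff_of_nonneg_ae hnn ((integrable_const _).sub hi)).1
    (by rw [hint]; linarith)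
  apply hW
  filter_upwards [hB, hV, hz, S.W_mem] with ω ⟨b, ku, kd, kw, ks⟩ hv hω hw
  simp only [Pi.zero_apply] at hω
  have hy : S.W ω - d.pW ≤ r.dW ω := by
    by_contra! hlt
    linarith [kw.nonneg_of_lt hlt]
  linarith [ku.1, ks.1, kd.2.1, hw.1]

theorem equilibriumSolutions_subset [IsProbabilityMeasure P] (S : PowerSystem P) (hc : S.cI < S.cF)
    (hW : ¬ (∀ᵐ ω ∂P, S.W ω = 0)) {l pHat : ℝ} (hI : l ≤ S.capI) :
    S.equilibriumSolutions l pHat ⊆ S.bilevelSolutions l := by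
  rintro _ ⟨d, r, pV, dV, lamF, lamB, heq, rfl⟩
  have hlam : ∫ ω, lamB ω ∂P = lamF := by
    obtain ⟨_, _, _, _, _, _, η, _, h1, h2⟩ := heq
    have : ∫ ω, lamB ω ∂P = ∫ ω, η ω ∂P := integral_congr_ae (by
      filter_upwards [h2] with ω hω using sub_eq_zero.1 hω)
    linarith
  have hpF := heq.pF_eq_zero hc hW hI hlam
  obtain ⟨hm, hmV, hi, ⟨hbal, kF, kI, kW⟩, hB, hV, _⟩ := heq
  rw [hpF] at hbal
  have hpI : d.pI = l - (d.pW + pV) := by linarith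
  have hx0 : 0 ≤ d.pW + pV := by
    obtain ⟨ω, ⟨b, ku, kd, kw, ks⟩, hv⟩ := (hB.and hV).exists
    linarith [ku.1, kd.1, kd.2.1, kw.1, ks.1]
  have hxW : d.pW + pV ≤ S.capW := by
    by_contra! hlt
    -- a position above `p̄_W` has to be covered by the flexible unit or by shedding in all scenarios
    have hge : ∀ᵐ ω ∂P, S.cUp ≤ lamB ω := by
      filter_upwards [hB, hV, S.W_mem] with ω ⟨b, ku, kd, kw, ks⟩ hv hw
      by_contra! hl
      have h1 : r.up ω ≤ 0 := by
        by_contra! h; linarith [ku.nonpos_of_lt h]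
      have h2 : r.shed ω ≤ 0 := by
        by_contra! h; linarith [ks.nonpos_of_lt h, S.cUp_lt_v]
      linarith [kd.1, kw.2.1, kd.2.1]
    have h1 := integral_mono_ae (integrable_const S.cUp) hi hge
    simp only [integral_const, probReal_univ, one_smul] at h1
    have h2 : S.capI ≤ d.pI := by
      by_contra! hl
      linarith [kI.nonneg_of_lt hl, S.cF_le_cUp]
    linarith [S.capW_pos]
  have hf : S.BilevelFeasible l ⟨d.pF, d.pI, d.pW + pV⟩
      ⟨r.up, r.dn, fun ω => r.dW ω + dV ω, r.shed⟩ := by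
    refine ⟨⟨hm.1, hm.2.1, hm.2.2.1.add hmV, hm.2.2.2⟩, hx0, hxW, ?_,
      (S.lowerOptimal_iff hc hI hx0).2 ⟨hpF, hpI, by linarith [kI.1]⟩⟩
    filter_upwards [hB, hV] with ω ⟨b, ku, kd, kw, ks⟩ hv
    exact ⟨by linarith, ⟨ku.1, ku.2.1⟩, ⟨kd.1, kd.2.1⟩,
      ⟨by linarith [kw.1], by linarith [kw.2.1]⟩, ks.1, ks.2.1⟩
  refine ⟨hf, fun d' r' hf' => ?_⟩
  dsimp only
  have hi1 := hf.integrable_cost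
  have hi2 := hf'.integrable_cost
  obtain ⟨_, h0', _, hae', hlow'⟩ := hf'
  obtain ⟨hF', hI', hl'⟩ := (S.lowerOptimal_iff hc hI h0').1 hlow'
  -- the balancing prices bound the change of the recourse cost in each scenario
  have hpt : ∀ᵐ ω ∂P, (S.cUp * r.up ω - S.cDn * r.dn ω + S.v * r.shed ω) +
      lamB ω * (d'.pW - (d.pW + pV)) ≤
      S.cUp * r'.up ω - S.cDn * r'.dn ω + S.v * r'.shed ω := by
    filter_upwards [hB, hV, hae'] with ω ⟨b, ku, kd, kw, ks⟩ hv
        ⟨b', ⟨u1, u2⟩, ⟨d1, d2⟩, ⟨y1, y2⟩, s1, s2⟩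
    have t1 := ku.variational u1 (by rwa [hpF, ← hF'])
    have t2 := kd.variational d1 (by rwa [hpF, ← hF'])
    have t3 := kw.variational (y := d'.pW + r'.dW ω - d.pW) (by linarith) (by linarith)
    have t4 := ks.variational s1 s2
    have e : d'.pW - (d.pW + pV) = (r'.up ω - r.up ω) - (r'.dn ω - r.dn ω) +
        (d'.pW + r'.dW ω - d.pW - r.dW ω) + (r'.shed ω - r.shed ω) := by linarith
    rw [e]
    linarith
  have hint := integral_mono_ae (hi1.add (hi.mul_const (d'.pW - (d.pW + pV)))) hi2 hpt
  simp only [Pi.add_apply] at hint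
  rw [integral_add hi1 (hi.mul_const _), integral_mul_const, hlam] at hint
  have t5 := kI.variational (y := l - d'.pW) (by linarith) (by linarith)
  unfold expectedCost
  dsimp only
  rw [hF', hI', hpF, hpI]
  rw [hpI] at t5
  linarith

end PowerSystem

theorem mainTheorem12 {Ω : Type*} [MeasurableSpace Ω] (P : Measure Ω) [IsProbabilityMeasure P]
    (S : PowerSystem P) (l pHat : ℝ) (hl : 0 ≤ l) (hHat : 0 ≤ pHat)
    (hc : S.cI < S.cF) (hW : ¬ (∀ᵐ ω ∂P, S.W ω = 0)) (hI : l ≤ S.capI) :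
    -- the minimum defining `l₂` exists
    IsLeast S.l2Set S.l2 ∧
    -- the two models have the same solutions
    S.bilevelSolutions l = S.equilibriumSolutions l pHat ∧
    -- rule 1: the only optimal forward dispatch is `p_W = l`
    (l ≤ S.l2 →
      (∃ r, ((⟨0, 0, l⟩ : ForwardDispatch), r) ∈ S.bilevelSolutions l) ∧
      ∀ d r, (d, r) ∈ S.bilevelSolutions l → d = ⟨0, 0, l⟩) ∧
    -- rule 2: `p_W = l₂`, `p_I = l - l₂` is optimal, with the smallest `p_W` among all solutions,
    -- and it is the only one unless `expectedPrice` stays at the level `c_I` to the right of `l₂`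
    (S.l2 < l →
      (∃ r, ((⟨0, l - S.l2, S.l2⟩ : ForwardDispatch), r) ∈ S.bilevelSolutions l) ∧
      (∀ d r, (d, r) ∈ S.bilevelSolutions l →
        d.pF = 0 ∧ d.pI = l - d.pW ∧ S.l2 ≤ d.pW) ∧
      ((∀ x, S.l2 < x → S.cI < S.expectedPrice x) →
        ∀ d r, (d, r) ∈ S.bilevelSolutions l → d = ⟨0, l - S.l2, S.l2⟩)) := by
  obtain ⟨hl2, -⟩ := S.isLeast_l2 hc
  -- below `l`, a minimizer belongs to the set whose minimum is `l₂`
  have hge : ∀ x, S.IsMinimizer l x → x < l → S.l2 ≤ x := fun x hx hlt =>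
    hl2.2 ⟨hx.1.1, ((S.isMinimizer_iff hc).1 hx).2.2 hlt⟩
  have hsol := fun d r h => (S.mem_bilevelSolutions_iff hc hI d r).1 h
  refine ⟨hl2, (S.bilevelSolutions_subset hc hI hHat).antisymm
    (S.equilibriumSolutions_subset hc hW hI), fun h => ⟨?_, fun d r hdr => ?_⟩,
    fun h => ⟨?_, fun d r hdr => ?_, fun hA d r hdr => ?_⟩⟩
  · have := S.mem_bilevelSolutions_of_isMinimizer hc hI
      (S.isMinimizer_of_le_l2 hc hl le_rfl h fun h' => absurd h' (lt_irrefl _))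
    rw [sub_self] at this
    exact ⟨_, this⟩
  · obtain ⟨hd, hmin, -⟩ := hsol d r hdr
    have : d.pW = l := by
      by_contra hne
      have hlt := lt_of_le_of_ne hmin.1.2.1 hne
      linarith [hge _ hmin hlt]
    rw [hd, this, sub_self]
  · exact ⟨_, S.mem_bilevelSolutions_of_isMinimizer hc hI
      (S.isMinimizer_of_le_l2 hc hl2.1.1 h.le le_rfl fun _ => rfl)⟩
  · obtain ⟨hd, hmin, -⟩ := hsol d r hdr
    refine ⟨congrArg ForwardDispatch.pF hd, congrArg ForwardDispatch.pI hd, ?_⟩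
    rcases hmin.1.2.1.eq_or_lt with e | hlt
    · exact e ▸ h.le
    · exact hge _ hmin hlt
  · obtain ⟨hd, hmin, -⟩ := hsol d r hdr
    have : d.pW = S.l2 := by
      refine le_antisymm ?_ ?_
      · by_contra! hlt
        -- a point strictly between `l₂` and a larger minimizer would have price at most `c_I`
        obtain ⟨y, h1, h2⟩ := exists_between hlt
        linarith [hA y h1, hmin.expectedPrice_le (hl2.1.1.trans h1.le) h2]
      · rcases hmin.1.2.1.eq_or_lt with e | hlt
        · exact e ▸ h.le
        · exact hge _ hmin hlt
    rw [hd, this]
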